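/- Let $\Lambda\subseteq\mathbb R$ (or, more generally, let $\Lambda$ be any set) be equipped with a $\sigma$-algebra, and let $\xi=\{\xi(t),t\in\mathbb R\}$ be a complex-valued centered second order process on a probability space, with covariance $$\mathsf E\,\xi(t)\overline{\xi(s)}=\int_\Lambda\int_\Lambda f(t,\lambda)\overline{f(s,\mu)}\,F_\xi(d\lambda,d\mu)\qquad(t,s\in\mathbb R),$$ where the integral exists as a Lebesgue integral, $F_\xi$ is a positive definite complex measure on $\Lambda\times\Lambda$ with (finite) total variation $\|F_\xi\|(\Lambda,\Lambda)=\int_\Lambda\int_\Lambda|F_\xi(d\lambda,d\mu)|$, and for each $\lambda\in\Lambda$ the function $f(\cdot,\lambda)$ is entire with $|f(z,\lambda)|\le Me^{\alpha|z|}$ for all $z\in\mathbb C$ and some $M>0$, $\alpha\in\mathbb R$ (a Piranashvili process with exponentially bounded kernel $f$). Let $$\gamma:=\sup_{\lambda\in\Lambda}\limsup_{n\to\infty}|f^{(n)}(0,\lambda)|^{1/n}<w<\infty,$$ where derivatives are with respect to the first variable, and let $$Y_N(\xi;t):=\sum_{n\in\mathbb Z:\,|tw/\pi-n|\le N}\xi\Big(\frac{n\pi}w\Big)\frac{\sin(wt-n\pi)}{wt-n\pi},$$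 $$\widetilde L_f:=\sup_{t\in\mathbb R}\sup_{\lambda\in\Lambda}|f(t,\lambda)|\in[0,\infty],\qquad \widetilde L_0(t):=\frac{4\widetilde L_f\,w\,|\sin(wt)|}{\pi(w-\gamma)(1-e^{-\pi})},$$ where $\frac{\sin x}{x}=1$ at $x=0$ and $0\cdot\infty=0$. Then there is $N_0$ such that for all integers $N\ge N_0$ and all $t\in\mathbb R$ $$\mathsf E\big|\xi(t)-Y_N(\xi;t)\big|^2\le\frac{\widetilde L_0(t)^2}{N^2}\,\|F_\xi\|(\Lambda,\Lambda),$$ and the inequality is strict whenever $\sin(wt)\ne0$, $\widetilde L_f\ne0$ and $\|F_\xi\|(\Lambda,\Lambda)\ne0$. -/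

import Mathlib

/-!
Expanding the square, `E |∑ aᵢ ξ(tᵢ)|²` is the double integral of `r(l) r(m)*` against `F`, where
`r(l) = ∑ aᵢ f(tᵢ, l)`. So it suffices to bound, uniformly in `l`, the truncation error of the
sampling series of the entire function `g = f(·, l)`. After rescaling to sampling points `n ∈ ℤ`,
the residue theorem writes that error at `x` as `sin(πx) / (2πi)` times the integral of
`g(ζ) / ((ζ - x) sin(πζ))` over the boundary of a rectangle whose vertical sides pass through
half-integers, where `|sin(πζ)| = cosh(π Im ζ)`. By Phragmén–Lindelöf, `|g(ζ)| ≤ L exp(γ |Im ζ|)`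
with `γ < π`, so the horizontal sides contribute nothing in the limit and the vertical ones,
at distance at least `N / 2` from `x`, contribute `O(1 / N)`. The resulting constant is smaller than
the stated one by a factor of at least `π / 2 > 1`, which gives the strict inequality.
-/

open MeasureTheory Filter
open scoped ENNReal ComplexConjugate ComplexOrder

/-- A complex measure `F` on `Λ × Λ` is positive definite if `∑ᵢ ∑ⱼ cᵢ c̄ⱼ F(Sᵢ × Sⱼ)` is real and
nonnegative for all finite families of measurable sets `Sᵢ ⊆ Λ` and complex numbers `cᵢ`. -/
def IsPosDefMeasure {Λ : Type*} [MeasurableSpace Λ] (F : ComplexMeasure (Λ × Λ)) : Prop :=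
  ∀ (n : ℕ) (S : Fin n → Set Λ) (c : Fin n → ℂ), (∀ i, MeasurableSet (S i)) →
    0 ≤ ∑ i, ∑ j, c i * conj (c j) * F (S i ×ˢ S j)

/-- The kernel `f(·, l)`, given as a function on the complex plane, is for every `l` an entire
function with `|f(z, l)| ≤ M exp (α |z|)` for some constants `M > 0` and `α` (these may depend on
`l`). -/
def IsExpBoundedKernel {Λ : Type*} (f : ℂ → Λ → ℂ) : Prop :=
  ∀ l : Λ, Differentiable ℂ (fun z => f z l) ∧
    ∃ M : ℝ, 0 < M ∧ ∃ α : ℝ, ∀ z : ℂ, ‖f z l‖ ≤ M * Real.exp (α * ‖z‖)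

/-- The exponential type `γ = sup_l limsup_n |f⁽ⁿ⁾(0, l)|^(1/n)` of a kernel, in `[0, ∞]`. -/
noncomputable def kernelType {Λ : Type*} (f : ℂ → Λ → ℂ) : ℝ≥0∞ :=
  ⨆ l : Λ, limsup (fun n : ℕ => ‖iteratedDeriv n (fun z => f z l) 0‖ₑ ^ ((1 : ℝ) / n)) atTop

/-- `sup_{t ∈ ℝ} sup_{l ∈ Λ} |f(t, l)|`, in `[0, ∞]`. -/
noncomputable def kernelSup {Λ : Type*} (f : ℂ → Λ → ℂ) : ℝ≥0∞ :=
  ⨆ (t : ℝ) (l : Λ), ‖f (t : ℂ) l‖ₑ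

/-- `ξ` is a Piranashvili process on the probability space `(Ω, P)` with kernel `f` and spectral
measure `F` on `Λ × Λ`: a centered second order process whose covariance has the representation
`E ξ(t) ξ(s)* = ∫∫ f(t, l) f(s, m)* F(dl, dm)`, where `f` is an exponentially bounded kernel and `F`
is a positive definite complex measure of finite total variation. The index set `Λ` is any measurable space, such as a subset
of `ℝ` with some sigma-algebra. -/
structure IsPiranashvili {Ω Λ : Type*} [MeasurableSpace Ω] [MeasurableSpace Λ] (P : Measure Ω)
    (ξ : ℝ → Ω → ℂ) (f : ℂ → Λ → ℂ) (F : ComplexMeasure (Λ × Λ)) : Prop where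
  memLp : ∀ t, MemLp (ξ t) 2 P
  centered : ∀ t, ∫ ω, ξ t ω ∂P = 0
  kernel : IsExpBoundedKernel f
  posDef : IsPosDefMeasure F
  finiteVariation : F.variation Set.univ < ∞
  /-- The double integral in the covariance representation exists as a Lebesgue integral. -/
  integrable : ∀ t s : ℝ,
    Integrable (fun p : Λ × Λ => f (t : ℂ) p.1 * conj (f (s : ℂ) p.2)) F.variation
  covariance : ∀ t s : ℝ, ∫ ω, ξ t ω * conj (ξ s ω) ∂P =
    F.integral (fun p : Λ × Λ => f (t : ℂ) p.1 * conj (f (s : ℂ) p.2))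
      (ContinuousLinearMap.mul ℝ ℂ)

/-- The finite set of sampling indices `{n ∈ ℤ : |t w / π - n| ≤ N}`. -/
noncomputable def sampleIndices (w : ℝ) (N : ℕ) (t : ℝ) : Finset ℤ :=
  Finset.Icc ⌈t * w / Real.pi - N⌉ ⌊t * w / Real.pi + N⌋

theorem mem_sampleIndices (w : ℝ) (N : ℕ) (t : ℝ) (n : ℤ) :
    n ∈ sampleIndices w N t ↔ |t * w / Real.pi - n| ≤ N := by
  rw [sampleIndices, Finset.mem_Icc, Int.ceil_le, Int.le_floor, abs_le]
  constructor <;> rintro ⟨h₁, h₂⟩ <;> constructor <;> linarith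

/-- The time shifted truncated Whittaker–Kotel'nikov–Shannon sum
`Y_N(ξ; t) = ∑_{|tw/π - n| ≤ N} ξ(nπ/w) sin(wt - nπ)/(wt - nπ)`
(with the value `1` of `sin x / x` at `x = 0`). -/
noncomputable def truncSum {Ω : Type*} (w : ℝ) (N : ℕ) (ξ : ℝ → Ω → ℂ) (t : ℝ) (ω : Ω) : ℂ :=
  ∑ n ∈ sampleIndices w N t,
    ξ (n * Real.pi / w) ω * (Real.sinc (w * t - n * Real.pi) : ℂ)

/-- `4 L w |sin(wt)| / (π (w - γ) (1 - e^(-π)))` with `L = kernelSup f` and `γ = kernelType f`, in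
`[0, ∞]` (with `∞ * 0 = 0`). -/
noncomputable def truncConst {Λ : Type*} (w : ℝ) (f : ℂ → Λ → ℂ) (t : ℝ) : ℝ≥0∞ :=
  4 * kernelSup f * ENNReal.ofReal (w * |Real.sin (w * t)| /
    (Real.pi * (w - (kernelType f).toReal) * (1 - Real.exp (-Real.pi))))

open Asymptotics Complex Set
open scoped Real Topology Interval

section ExponentialType

variable {E : Type*} [NormedAddCommGroup E]

theorem isBigO_pow_of_limsup_enorm_rpow_lt {a : ℕ → E} {τ : ℝ}
    (h : limsup (fun n : ℕ ↦ ‖a n‖ₑ ^ ((1 : ℝ) / n)) atTop < ENNReal.ofReal τ) :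
    a =O[atTop] fun n ↦ τ ^ n := by
  have hτ : 0 < τ := ENNReal.ofReal_pos.1 (bot_le.trans_lt h)
  refine .of_bound 1 ?_
  filter_upwards [eventually_lt_of_limsup_lt h, eventually_ne_atTop 0] with n hn hn0
  rw [one_mul, norm_pow, Real.norm_of_nonneg hτ.le, ← ENNReal.ofReal_le_ofReal_iff (by positivity),
    ofReal_norm, ENNReal.ofReal_pow hτ.le]
  calc ‖a n‖ₑ = (‖a n‖ₑ ^ ((1 : ℝ) / n)) ^ n := by
        rw [← ENNReal.rpow_mul_natCast, one_div_mul_cancel (by exact_mod_cast hn0),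
          ENNReal.rpow_one]
    _ ≤ ENNReal.ofReal τ ^ n := by gcongr

variable [NormedSpace ℂ E] {g : ℂ → E} {τ : ℝ}

theorem isBigO_exp_of_iteratedDeriv_isBigO_pow [CompleteSpace E] (hg : Differentiable ℂ g)
    (hτ : 0 < τ) (h : (fun n ↦ iteratedDeriv n g 0) =O[atTop] fun n : ℕ ↦ τ ^ n) :
    g =O[⊤] fun z ↦ Real.exp (τ * ‖z‖) := by
  obtain ⟨C, -, hC⟩ := bound_of_isBigO_nat_atTop h
  refine .of_bound C (.of_forall fun z ↦ ?_)
  have hexp : HasSum (fun n : ℕ ↦ C * ((τ * ‖z‖) ^ n / n.factorial))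
      (C * Real.exp (τ * ‖z‖)) := by
    rw [Real.exp_eq_exp_ℝ]
    exact (NormedSpace.expSeries_div_hasSum_exp (τ * ‖z‖)).mul_left C
  rw [← (hasSum_taylorSeries_of_entire hg 0 z).tsum_eq, Real.norm_of_nonneg (Real.exp_pos _).le]
  refine tsum_of_norm_bounded hexp fun n ↦ ?_
  have hCn : ‖iteratedDeriv n g 0‖ ≤ C * τ ^ n := by
    simpa only [norm_pow, Real.norm_of_nonneg hτ.le] using hC (x := n) (by positivity)
  calc ‖(n.factorial : ℂ)⁻¹ • (z - 0) ^ n • iteratedDeriv n g 0‖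
      = ‖iteratedDeriv n g 0‖ * (‖z‖ ^ n / n.factorial) := by
        simp only [sub_zero, norm_smul, norm_inv, norm_pow, RCLike.norm_natCast]
        ring
    _ ≤ C * τ ^ n * (‖z‖ ^ n / n.factorial) := by gcongr
    _ = C * ((τ * ‖z‖) ^ n / n.factorial) := by ring

theorem norm_le_mul_exp_im_of_im_nonneg (hg : Differentiable ℂ g)
    (hτ : g =O[⊤] fun z ↦ Real.exp (τ * ‖z‖)) {L : ℝ} (hL : ∀ x : ℝ, ‖g x‖ ≤ L) {z : ℂ}
    (hz : 0 ≤ z.im) : ‖g z‖ ≤ L * Real.exp (τ * z.im) := by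
  obtain ⟨C, hC⟩ := isBigO_top.1 hτ
  simp only [Real.norm_of_nonneg (Real.exp_pos _).le] at hC
  -- Turn the upper half-plane into the right one and divide by `exp (-τ * I * z)`.
  let h : ℂ → E := fun ζ ↦ cexp (-τ * ζ) • g (I * ζ)
  have norm_h (ζ : ℂ) : ‖h ζ‖ = ‖g (I * ζ)‖ / Real.exp (τ * ζ.re) := by
    simp only [h, norm_smul, norm_exp, neg_mul, neg_re, re_ofReal_mul, Real.exp_neg]
    rw [inv_mul_eq_div]
  have h_growth : h =O[⊤] fun ζ ↦ Real.exp ((τ + |τ|) * ‖ζ‖ ^ (1 : ℝ)) := by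
    refine .of_bound C (.of_forall fun ζ ↦ ?_)
    have hC0 : 0 ≤ C := by simpa using (norm_nonneg _).trans (hC 0)
    have hτζ : -(τ * ζ.re) ≤ |τ| * ‖ζ‖ :=
      (neg_le_abs _).trans ((abs_mul _ _).trans_le (by gcongr; exact abs_re_le_norm ζ))
    rw [norm_h, div_le_iff₀ (Real.exp_pos _), Real.rpow_one,
      Real.norm_of_nonneg (Real.exp_pos _).le, mul_assoc, ← Real.exp_add]
    calc ‖g (I * ζ)‖ ≤ C * Real.exp (τ * ‖ζ‖) := by simpa using hC (I * ζ)
      _ ≤ C * Real.exp ((τ + |τ|) * ‖ζ‖ + τ * ζ.re) := by gcongr; linarith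
  have h_le : ‖h (-I * z)‖ ≤ L := by
    refine PhragmenLindelof.right_half_plane_of_bounded_on_real
      (Differentiable.diffContOnCl (by fun_prop)) ⟨1, by norm_num, _, h_growth.mono le_top⟩
      (isBoundedUnder_of_eventually_le (a := C) ?_) (fun x ↦ ?_) (by simpa using hz)
    · filter_upwards [eventually_ge_atTop 0] with x hx
      rw [norm_h, div_le_iff₀ (Real.exp_pos _), ofReal_re]
      simpa [abs_of_nonneg hx] using hC (I * x)
    · have hIx : I * (x * I) = (-x : ℝ) := by
        push_cast
        linear_combination (x : ℂ) * I_mul_I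
      rw [norm_h, hIx]
      simpa using hL (-x)
  have hIz : I * (-I * z) = z := by linear_combination -z * I_mul_I
  rwa [norm_h, hIz, div_le_iff₀ (Real.exp_pos _), show (-I * z).re = z.im by simp] at h_le

theorem norm_le_mul_exp_abs_im (hg : Differentiable ℂ g)
    (hτ : g =O[⊤] fun z ↦ Real.exp (τ * ‖z‖)) {L : ℝ} (hL : ∀ x : ℝ, ‖g x‖ ≤ L) (z : ℂ) :
    ‖g z‖ ≤ L * Real.exp (τ * |z.im|) := by
  rcases le_total 0 z.im with hz | hz
  · rw [abs_of_nonneg hz]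
    exact norm_le_mul_exp_im_of_im_nonneg hg hτ hL hz
  · have hτ' : (fun ζ ↦ g (-ζ)) =O[⊤] fun ζ ↦ Real.exp (τ * ‖ζ‖) := by
      simpa only [Function.comp_def, norm_neg] using hτ.comp_tendsto (k := Neg.neg) tendsto_top
    rw [abs_of_nonpos hz]
    simpa using norm_le_mul_exp_im_of_im_nonneg (z := -z) (by fun_prop) hτ'
      (fun x ↦ by simpa using hL (-x)) (by simpa using hz)

end ExponentialType

section RectIntegral

theorem mul_intervalIntegral_inv_eq_log_sub_log {γ : ℝ → ℂ} {c ω : ℂ} {a b : ℝ} (hω : ω ≠ 0)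
    (hγ : ∀ x, HasDerivAt γ c x) (h : ∀ x, ω * γ x ∈ slitPlane) :
    c * ∫ x in a..b, (γ x)⁻¹ = log (ω * γ b) - log (ω * γ a) := by
  have hne x : γ x ≠ 0 := right_ne_zero_of_mul (slitPlane_ne_zero (h x))
  have hder x : HasDerivAt (fun x ↦ log (ω * γ x)) (c * (γ x)⁻¹) x :=
    (((hγ x).const_mul ω).clog_real (h x)).congr_deriv (by field [hne x])
  have hcont : Continuous γ := continuous_iff_continuousAt.2 fun x ↦ (hγ x).continuousAt
  rw [← intervalIntegral.integral_const_mul]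
  refine intervalIntegral.integral_eq_sub_of_hasDerivAt (fun x _ ↦ hder x)
    (Continuous.intervalIntegrable ?_ a b)
  fun_prop (disch := assumption)

theorem log_I_mul_of_re_pos {v : ℂ} (hv : 0 < v.re) : log (I * v) = log v + π / 2 * I := by
  have harg := abs_lt.1 (abs_arg_lt_pi_div_two_iff.2 (.inl hv))
  rw [log_mul I_ne_zero (by rintro rfl; simp at hv), log_I, add_comm]
  rw [arg_I]
  constructor <;> linarith

variable {E : Type*} [NormedAddCommGroup E] [NormedSpace ℂ E] {f g : ℂ → E} {z w p : ℂ}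

/-- The integral of `f` over the boundary of the rectangle with corners `z` and `w`, positively
oriented when `z` is the lower left corner. It has the shape of the left-hand side of
`Complex.integral_boundary_rect_eq_zero_of_differentiableOn`. -/
noncomputable def rectIntegral (f : ℂ → E) (z w : ℂ) : E :=
  (∫ x : ℝ in z.re..w.re, f (x + z.im * I)) - (∫ x : ℝ in z.re..w.re, f (x + w.im * I)) +
    I • (∫ y : ℝ in z.im..w.im, f (w.re + y * I)) - I • ∫ y : ℝ in z.im..w.im, f (z.re + y * I)

theorem frontier_rectangle (z w : ℂ) : frontier (Rectangle z w) =
    [[z.re, w.re]] ×ℂ {z.im, w.im} ∪ {z.re, w.re} ×ℂ [[z.im, w.im]] := by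
  have frontier_uIcc (a b : ℝ) : frontier [[a, b]] = {a, b} := by
    rcases le_total a b with h | h
    · rw [uIcc_of_le h, frontier_Icc h]
    · rw [uIcc_of_ge h, frontier_Icc h, pair_comm]
  simp_rw [Rectangle, frontier_reProdIm, frontier_uIcc, uIcc, isClosed_Icc.closure_eq]

theorem rectIntegral_congr (h : EqOn f g (frontier (Rectangle z w))) :
    rectIntegral f z w = rectIntegral g z w := by
  simp only [frontier_rectangle] at h
  unfold rectIntegral
  refine congrArg₂ _ (congrArg₂ _ (congrArg₂ _ ?_ ?_) (congrArg _ ?_)) (congrArg _ ?_) <;>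
    refine intervalIntegral.integral_congr fun x hx ↦ h ?_ <;>
      simp [mem_reProdIm, hx]

theorem rectIntegral_add (hf : ContinuousOn f (frontier (Rectangle z w)))
    (hg : ContinuousOn g (frontier (Rectangle z w))) :
    rectIntegral (fun ζ ↦ f ζ + g ζ) z w = rectIntegral f z w + rectIntegral g z w := by
  unfold rectIntegral
  rw [intervalIntegral.integral_add, intervalIntegral.integral_add, intervalIntegral.integral_add,
    intervalIntegral.integral_add]
  · module
  all_goals
    refine ContinuousOn.intervalIntegrable (ContinuousOn.comp' ‹_› (by fun_prop) fun x hx ↦ ?_)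
    simp [frontier_rectangle, mem_reProdIm, hx]

theorem rectIntegral_smul_const [CompleteSpace E] (f : ℂ → ℂ) (c : E) (z w : ℂ) :
    rectIntegral (fun ζ ↦ f ζ • c) z w = rectIntegral f z w • c := by
  simp only [rectIntegral, intervalIntegral.integral_smul_const, sub_smul, add_smul, smul_assoc]

theorem rectIntegral_inv_sub (hre : z.re ≤ w.re) (him : z.im ≤ w.im)
    (hp : p ∈ interior (Rectangle z w)) : rectIntegral (fun ζ ↦ (ζ - p)⁻¹) z w = 2 * π * I := by
  rw [Rectangle, uIcc_of_le hre, uIcc_of_le him, interior_reProdIm, interior_Icc,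
    interior_Icc] at hp
  obtain ⟨⟨hzre, hwre⟩, hzim, hwim⟩ := hp
  -- Seen from `p`, each side lies in an open half-plane, where a rotated logarithm is a primitive.
  have horizontal (y : ℝ) {ω : ℂ} (hω : ω ≠ 0)
      (h : ∀ x : ℝ, ω * (x + y * I - p) ∈ slitPlane) :
      ∫ x : ℝ in z.re..w.re, (x + y * I - p)⁻¹ =
        log (ω * (w.re + y * I - p)) - log (ω * (z.re + y * I - p)) := by
    rw [← mul_intervalIntegral_inv_eq_log_sub_log (γ := fun x : ℝ ↦ x + y * I - p) hω
      (fun x ↦ ((hasDerivAt_id x).ofReal_comp.add_const _).sub_const _) h, ofReal_one, one_mul]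
  have vertical (x : ℝ) {ω : ℂ} (hω : ω ≠ 0)
      (h : ∀ y : ℝ, ω * (x + y * I - p) ∈ slitPlane) :
      I • ∫ y : ℝ in z.im..w.im, (x + y * I - p)⁻¹ =
        log (ω * (x + w.im * I - p)) - log (ω * (x + z.im * I - p)) := by
    refine mul_intervalIntegral_inv_eq_log_sub_log hω (fun y ↦ ?_) h
    simpa using (((hasDerivAt_id y).ofReal_comp.mul_const I).const_add (x : ℂ)).sub_const p
  rw [rectIntegral, horizontal z.im I_ne_zero fun x ↦ .inl (by simpa using hzim),
    horizontal w.im (neg_ne_zero.2 I_ne_zero) fun x ↦ .inl (by simpa using hwim),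
    vertical w.re one_ne_zero fun y ↦ .inl (by simpa using hwre),
    vertical z.re (neg_ne_zero.2 one_ne_zero) fun y ↦ .inl (by simpa using hzre)]
  have corner {α β : ℂ} (hβ : I * β = α) {v : ℂ} (hv : 0 < (β * v).re) :
      log (α * v) = log (β * v) + π / 2 * I := by
    rw [← log_I_mul_of_re_pos hv, ← mul_assoc, hβ]
  linear_combination
    corner (mul_one I) (v := w.re + z.im * I - p) (by simpa using hwre) +
    corner (α := 1) (β := -I) (by simp) (v := w.re + w.im * I - p) (by simpa using hwim) +
    corner (mul_neg_one I) (v := z.re + w.im * I - p) (by simpa using hzre) +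
    corner I_mul_I (v := z.re + z.im * I - p) (by simpa using hzim)

variable [CompleteSpace E]

theorem exists_eq_add_inv_sub_smul {U : Set ℂ} {c : E} (hU : U ∈ 𝓝 p)
    (hf : DifferentiableOn ℂ f (U \ {p}))
    (hc : Tendsto (fun ζ ↦ (ζ - p) • f ζ) (𝓝[≠] p) (𝓝 c)) :
    ∃ ψ : ℂ → E, DifferentiableOn ℂ ψ U ∧ ∀ ζ ≠ p, f ζ = ψ ζ + (ζ - p)⁻¹ • c := by
  let F := Function.update (fun ζ ↦ (ζ - p) • f ζ) p c
  have hFne ζ (hζ : ζ ≠ p) : F ζ = (ζ - p) • f ζ := Function.update_of_ne hζ _ _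
  have hF : DifferentiableOn ℂ F U := by
    refine (differentiableOn_compl_singleton_and_continuousAt_iff hU).1
      ⟨?_, continuousAt_update_same.2 hc⟩
    exact (DifferentiableOn.smul (by fun_prop) hf).congr fun ζ hζ ↦ hFne ζ hζ.2
  refine ⟨dslope F p, (differentiableOn_dslope hU).2 hF, fun ζ hζ ↦ ?_⟩
  rw [dslope_of_ne _ hζ, slope_def_module, hFne ζ hζ, ← smul_add, show F p = c from
    Function.update_self .., sub_add_cancel, inv_smul_smul₀ (sub_ne_zero.2 hζ)]

theorem rectIntegral_eq_sum_residues {S : Finset ℂ} {r : ℂ → E} (hre : z.re ≤ w.re)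
    (him : z.im ≤ w.im) (hS : ↑S ⊆ interior (Rectangle z w))
    (hf : DifferentiableOn ℂ f (Rectangle z w \ S))
    (hr : ∀ p ∈ S, Tendsto (fun ζ ↦ (ζ - p) • f ζ) (𝓝[≠] p) (𝓝 (r p))) :
    rectIntegral f z w = (2 * π * I) • ∑ p ∈ S, r p := by
  have hclosed : IsClosed (Rectangle z w) := isClosed_Icc.reProdIm isClosed_Icc
  have hfr : frontier (Rectangle z w) ⊆ Rectangle z w := hclosed.frontier_subset
  have notMem_frontier q (hq : q ∈ interior (Rectangle z w)) : q ∉ frontier (Rectangle z w) :=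
    disjoint_interior_frontier.notMem_of_mem_left hq
  induction S using Finset.induction_on generalizing f with
  | empty =>
    rw [Finset.sum_empty, smul_zero]
    exact integral_boundary_rect_eq_zero_of_differentiableOn f z w (by simpa using! hf)
  | insert q S hqS ih =>
    simp only [Finset.coe_insert, insert_subset_iff, Finset.forall_mem_insert] at hS hr hf
    obtain ⟨hq, hS⟩ := hS
    have hU : Rectangle z w \ S ∈ 𝓝 q :=
      inter_mem (mem_interior_iff_mem_nhds.1 hq)
        (S.finite_toSet.isClosed.isOpen_compl.mem_nhds (by simpa using hqS))
    obtain ⟨ψ, hψ, hfψ⟩ := exists_eq_add_inv_sub_smul hU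
      (by rwa [sdiff_sdiff, union_singleton]) hr.1
    have hψr p (hp : p ∈ S) : Tendsto (fun ζ ↦ (ζ - p) • ψ ζ) (𝓝[≠] p) (𝓝 (r p)) := by
      have hpq : p ≠ q := ne_of_mem_of_not_mem hp hqS
      have hpole : Tendsto (fun ζ ↦ (ζ - p) • (ζ - q)⁻¹ • r q) (𝓝[≠] p) (𝓝 0) := by
        have : ContinuousAt (fun ζ ↦ (ζ - p) • (ζ - q)⁻¹ • r q) p := by
          fun_prop (disch := exact sub_ne_zero.2 hpq)
        simpa using this.continuousWithinAt.tendsto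
      rw [← sub_zero (r p)]
      refine ((hr.2 p hp).sub hpole).congr' ?_
      filter_upwards [nhdsWithin_le_nhds (isOpen_ne.mem_nhds hpq)] with ζ hζ
      rw [hfψ ζ hζ, smul_add, add_sub_cancel_right]
    have hne ζ (hζ : ζ ∈ frontier (Rectangle z w)) : ζ - q ≠ 0 :=
      sub_ne_zero.2 (ne_of_mem_of_not_mem hζ (notMem_frontier q hq))
    have hψc : ContinuousOn ψ (frontier (Rectangle z w)) := hψ.continuousOn.mono fun ζ hζ ↦
      ⟨hfr hζ, fun hζS ↦ notMem_frontier ζ (hS hζS) hζ⟩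
    rw [rectIntegral_congr fun ζ hζ ↦ hfψ ζ (sub_ne_zero.1 (hne ζ hζ)),
      rectIntegral_add hψc (by fun_prop (disch := assumption)), rectIntegral_smul_const,
      rectIntegral_inv_sub hre him hq, ih hS hψ hψr, Finset.sum_insert hqS, smul_add, add_comm]

end RectIntegral

section CardinalSeries

theorem norm_sin_sq (z : ℂ) : ‖sin z‖ ^ 2 = Real.sin z.re ^ 2 + Real.sinh z.im ^ 2 := by
  have hsin : sin z =
      (Real.sin z.re * Real.cosh z.im : ℝ) + (Real.cos z.re * Real.sinh z.im : ℝ) * I := by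
    conv_lhs => rw [← re_add_im z, sin_add_mul_I]
    push_cast
    ring
  rw [hsin, ← normSq_eq_norm_sq, normSq_add_mul_I, mul_pow, mul_pow, Real.cosh_sq, Real.cos_sq']
  ring

theorem sinh_abs_im_le_norm_sin (z : ℂ) : Real.sinh |z.im| ≤ ‖sin z‖ := by
  refine le_of_sq_le_sq ?_ (norm_nonneg _)
  rw [norm_sin_sq, ← Real.abs_sinh, sq_abs]
  exact le_add_of_nonneg_left (sq_nonneg _)

theorem norm_sin_of_cos_re_eq_zero {z : ℂ} (hz : Real.cos z.re = 0) :
    ‖sin z‖ = Real.cosh z.im := by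
  refine (sq_eq_sq₀ (norm_nonneg _) (Real.cosh_pos _).le).1 ?_
  rw [norm_sin_sq, Real.sin_sq, hz, Real.cosh_sq]
  ring

theorem exp_abs_div_two_le_cosh (y : ℝ) : Real.exp |y| / 2 ≤ Real.cosh y := by
  rw [← Real.cosh_abs, Real.cosh_eq]
  gcongr
  exact le_add_of_nonneg_right (Real.exp_pos _).le

theorem exp_div_four_le_sinh {y : ℝ} (hy : 1 ≤ y) : Real.exp y / 4 ≤ Real.sinh y := by
  have hexp : 2 ≤ Real.exp y := by linarith [Real.add_one_le_exp y]
  have hexp_neg : Real.exp (-y) ≤ 1 := Real.exp_le_one_iff.2 (by linarith)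
  rw [Real.sinh_eq]
  linarith

theorem integral_exp_neg_mul_abs {δ : ℝ} (hδ : 0 < δ) : ∫ y : ℝ, Real.exp (-δ * |y|) = 2 / δ := by
  rw [integral_comp_abs (f := fun y ↦ Real.exp (-δ * y)),
    integral_exp_mul_Ioi (neg_lt_zero.2 hδ) 0, mul_zero, Real.exp_zero]
  ring

variable {E : Type*} [NormedAddCommGroup E] [NormedSpace ℂ E] {g : ℂ → E}

theorem norm_intervalIntegral_le_of_norm_le_exp_neg_mul_abs {φ : ℝ → E} {K δ a b : ℝ} (hδ : 0 < δ)
    (hab : a ≤ b) (h : ∀ y, ‖φ y‖ ≤ K * Real.exp (-δ * |y|)) :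
    ‖∫ y in a..b, φ y‖ ≤ K * (2 / δ) := by
  have hK : 0 ≤ K := by simpa using (norm_nonneg _).trans (h 0)
  have hint : Integrable fun y : ℝ ↦ K * Real.exp (-δ * |y|) := by
    refine .const_mul (.of_integral_ne_zero ?_) K
    rw [integral_exp_neg_mul_abs hδ]
    positivity
  calc ‖∫ y in a..b, φ y‖
      ≤ ∫ y in a..b, K * Real.exp (-δ * |y|) :=
        intervalIntegral.norm_integral_le_of_norm_le hab (.of_forall fun y _ ↦ h y)
          hint.intervalIntegrable
    _ ≤ ∫ y, K * Real.exp (-δ * |y|) := by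
        rw [intervalIntegral.integral_of_le hab]
        exact setIntegral_le_integral hint (.of_forall fun y ↦ by positivity)
    _ = K * (2 / δ) := by rw [integral_const_mul, integral_exp_neg_mul_abs hδ]

theorem tendsto_sub_smul_inv_smul {u : ℂ → E} {v : ℂ → ℂ} {v' p : ℂ} (hu : ContinuousAt u p)
    (hv : HasDerivAt v v' p) (hvp : v p = 0) (hv' : v' ≠ 0) :
    Tendsto (fun ζ ↦ (ζ - p) • (v ζ)⁻¹ • u ζ) (𝓝[≠] p) (𝓝 (v'⁻¹ • u p)) := by
  refine (((hasDerivAt_iff_tendsto_slope.1 hv).inv₀ hv').smul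
    (hu.tendsto.mono_left nhdsWithin_le_nhds)).congr fun ζ ↦ ?_
  rw [slope_def_field, hvp, sub_zero, inv_div, div_eq_mul_inv, mul_smul]

theorem sinc_pi_mul_sub_intCast {x : ℝ} {n : ℤ} (hx : x ≠ n) :
    Real.sinc (π * (x - n)) = Real.sin (π * x) / ((x - n) * (π * Real.cos (π * n))) := by
  have hsub : x - n ≠ 0 := sub_ne_zero.2 hx
  have hcos : Real.cos (π * n) ^ 2 = 1 := by
    rw [← sq_abs, mul_comm, Real.abs_cos_int_mul_pi, one_pow]
  have hcos0 : Real.cos (π * n) ≠ 0 := by rintro h; simp [h] at hcos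
  rw [Real.sinc_of_ne_zero (by positivity), mul_sub, Real.sin_sub, mul_comm π (n : ℝ),
    Real.sin_int_mul_pi, mul_comm (n : ℝ) π]
  field_simp
  linear_combination Real.sin (π * x) * hcos

theorem hasDerivAt_sub_mul_sin_pi_mul (x p : ℂ) :
    HasDerivAt (fun ζ ↦ (ζ - x) * sin (π * ζ)) (sin (π * p) + (p - x) * (π * cos (π * p))) p := by
  refine (((hasDerivAt_id' p).sub_const x).mul
    ((hasDerivAt_id' p).const_mul (π : ℂ)).csin).congr_deriv ?_
  ring

theorem sin_pi_mul_eq_zero_iff {ζ : ℂ} : sin (π * ζ) = 0 ↔ ∃ n : ℤ, ζ = n := by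
  have hπ : (π : ℂ) ≠ 0 := ofReal_ne_zero.2 Real.pi_ne_zero
  simp only [Complex.sin_eq_zero_iff, mul_comm (π : ℂ), mul_left_inj' hπ]

theorem intCast_mem_Icc_of_mem_rectangle {m M n : ℤ} {Y : ℝ}
    (h : (n : ℂ) ∈ Rectangle ⟨m - 1 / 2, -Y⟩ ⟨M + 1 / 2, Y⟩) (hmM : (m - 1 / 2 : ℝ) ≤ M + 1 / 2) :
    n ∈ Finset.Icc m M := by
  have hre := h.1
  rw [mem_preimage, uIcc_of_le hmM, intCast_re] at hre
  have hm : ((m - 1 : ℤ) : ℝ) < n := by push_cast; linarith [hre.1]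
  have hM : (n : ℝ) < (M + 1 : ℤ) := by push_cast; linarith [hre.2]
  rw [Int.cast_lt] at hm hM
  exact Finset.mem_Icc.2 ⟨by lia, by lia⟩

theorem rectIntegral_inv_sub_mul_sin_smul [CompleteSpace E] (hg : Differentiable ℂ g) {m M : ℤ}
    {x Y : ℝ} (hx : x ∈ Ioo (m - 1 / 2 : ℝ) (M + 1 / 2)) (hsin : sin (π * x : ℂ) ≠ 0)
    (hY : 0 < Y) :
    rectIntegral (fun ζ ↦ ((ζ - x) * sin (π * ζ))⁻¹ • g ζ) ⟨m - 1 / 2, -Y⟩ ⟨M + 1 / 2, Y⟩ =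
      (2 * π * I) • ((sin (π * x))⁻¹ • g x +
        ∑ n ∈ Finset.Icc m M, ((n - x) * (π * cos (π * n)))⁻¹ • g n) := by
  have hsinn (n : ℤ) : sin (π * n) = 0 := sin_pi_mul_eq_zero_iff.2 ⟨n, rfl⟩
  have hxn (n : ℤ) : (n : ℂ) ≠ x := fun h ↦ hsin (h ▸ hsinn n)
  have hcosn (n : ℤ) : cos (π * n) ≠ 0 := fun h ↦ by
    simpa [h, hsinn] using sin_sq_add_cos_sq (π * n : ℂ)
  have hmM : (m - 1 / 2 : ℝ) ≤ M + 1 / 2 := (hx.1.trans hx.2).le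
  let v' : ℂ → ℂ := fun p ↦ sin (π * p) + (p - x) * (π * cos (π * p))
  let poles : Finset ℂ := insert ↑x ((Finset.Icc m M).map ⟨Int.cast, Int.cast_injective⟩)
  have mem_poles {p : ℂ} : p ∈ poles ↔ p = x ∨ ∃ n ∈ Finset.Icc m M, (n : ℂ) = p := by simp [poles]
  rw [rectIntegral_eq_sum_residues (S := poles) (r := fun p ↦ (v' p)⁻¹ • g p) hmM
    (neg_le_self hY.le), Finset.sum_insert (by simp [hxn]), Finset.sum_map]
  · simp [v', hsinn]
  · have hinterior {p : ℝ} (hp : p ∈ Ioo (m - 1 / 2 : ℝ) (M + 1 / 2)) :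
        (p : ℂ) ∈ interior (Rectangle ⟨m - 1 / 2, -Y⟩ ⟨M + 1 / 2, Y⟩) := by
      rw [Rectangle, interior_reProdIm, uIcc_of_le hmM, uIcc_of_le (neg_le_self hY.le),
        interior_Icc, interior_Icc]
      exact ⟨hp, by simpa using hY⟩
    rintro p hp
    obtain rfl | ⟨n, hn, rfl⟩ := mem_poles.1 hp
    · exact hinterior hx
    · obtain ⟨hmn, hnM⟩ := Finset.mem_Icc.1 hn
      have hmn' : (m : ℝ) ≤ n := by exact_mod_cast hmn
      have hnM' : (n : ℝ) ≤ M := by exact_mod_cast hnM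
      exact_mod_cast hinterior (p := n) ⟨by linarith, by linarith⟩
  · refine DifferentiableOn.smul (DifferentiableOn.inv (by fun_prop) fun ζ hζ h ↦ hζ.2 ?_)
      hg.differentiableOn
    rw [mul_eq_zero, sub_eq_zero, sin_pi_mul_eq_zero_iff] at h
    obtain rfl | ⟨n, rfl⟩ := h
    · exact mem_poles.2 (.inl rfl)
    · exact mem_poles.2 (.inr ⟨n, intCast_mem_Icc_of_mem_rectangle hζ.1 hmM, rfl⟩)
  · intro p hp
    refine tendsto_sub_smul_inv_smul hg.continuous.continuousAt
      (hasDerivAt_sub_mul_sin_pi_mul x p) ?_ ?_ <;>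
    obtain rfl | ⟨n, -, rfl⟩ := mem_poles.1 hp
    · simp
    · simp [hsinn]
    · simpa [v'] using hsin
    · simp [v', hsinn, sub_ne_zero.2 (hxn n), Real.pi_ne_zero, hcosn]

theorem sub_sum_sinc_smul_eq_rectIntegral [CompleteSpace E] (hg : Differentiable ℂ g) {m M : ℤ}
    {x Y : ℝ} (hx : x ∈ Ioo (m - 1 / 2 : ℝ) (M + 1 / 2)) (hsin : Real.sin (π * x) ≠ 0)
    (hY : 0 < Y) :
    g x - ∑ n ∈ Finset.Icc m M, (Real.sinc (π * (x - n)) : ℂ) • g n =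
      (sin (π * x) / (2 * π * I)) •
        rectIntegral (fun ζ ↦ ((ζ - x) * sin (π * ζ))⁻¹ • g ζ) ⟨m - 1 / 2, -Y⟩ ⟨M + 1 / 2, Y⟩ := by
  have hsin' : sin (π * x : ℂ) ≠ 0 := by exact_mod_cast hsin
  have hsinc (n : ℤ) : (Real.sinc (π * (x - n)) : ℂ) =
      -(sin (π * x) * ((n - x) * (π * cos (π * n)))⁻¹) := by
    rw [sinc_pi_mul_sub_intCast fun h ↦ hsin' (sin_pi_mul_eq_zero_iff.2 ⟨n, by simp [h]⟩),
      ← neg_sub (n : ℝ) x]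
    push_cast
    rw [neg_mul, div_neg, div_eq_mul_inv]
  rw [rectIntegral_inv_sub_mul_sin_smul hg hx hsin' hY, smul_smul,
    div_mul_cancel₀ _ two_pi_I_ne_zero, smul_add, smul_inv_smul₀ hsin', Finset.smul_sum]
  simp only [hsinc, neg_smul, Finset.sum_neg_distrib, sub_neg_eq_add, mul_smul]

variable {L γ x : ℝ} {ζ : ℂ}

theorem norm_inv_sub_mul_sin_smul_le (hg : ∀ z, ‖g z‖ ≤ L * Real.exp (γ * |z.im|)) {a d : ℝ}
    (ha : 0 < a) (hd : 0 < d) (hζ : d ≤ ‖ζ - x‖)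
    (hsin : Real.exp (π * |ζ.im|) * a ≤ ‖sin (π * ζ)‖) :
    ‖((ζ - x) * sin (π * ζ))⁻¹ • g ζ‖ ≤ L / (d * a) * Real.exp (-(π - γ) * |ζ.im|) := by
  have : 0 ≤ L := by simpa using (norm_nonneg _).trans (hg 0)
  calc ‖((ζ - x) * sin (π * ζ))⁻¹ • g ζ‖
      = (‖ζ - x‖ * ‖sin (π * ζ)‖)⁻¹ * ‖g ζ‖ := by rw [norm_smul, norm_inv, norm_mul]
    _ ≤ (d * (Real.exp (π * |ζ.im|) * a))⁻¹ * (L * Real.exp (γ * |ζ.im|)) := by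
        gcongr
        exact hg ζ
    _ = L / (d * a) * Real.exp (-(π - γ) * |ζ.im|) := by
        rw [show -(π - γ) * |ζ.im| = γ * |ζ.im| - π * |ζ.im| by ring, Real.exp_sub]
        field_simp

theorem norm_inv_sub_mul_sin_smul_le_of_cos_re_eq_zero
    (hg : ∀ z, ‖g z‖ ≤ L * Real.exp (γ * |z.im|)) (hζ : Real.cos (π * ζ.re) = 0) (hx : ζ.re ≠ x) :
    ‖((ζ - x) * sin (π * ζ))⁻¹ • g ζ‖ ≤
      2 * L / |ζ.re - x| * Real.exp (-(π - γ) * |ζ.im|) := by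
  refine (norm_inv_sub_mul_sin_smul_le hg one_half_pos (abs_pos.2 (sub_ne_zero.2 hx)) ?_
    ?_).trans_eq ?_
  · simpa using abs_re_le_norm (ζ - x)
  · rw [norm_sin_of_cos_re_eq_zero (by simpa using hζ), mul_one_div]
    simpa [abs_mul, abs_of_pos Real.pi_pos] using exp_abs_div_two_le_cosh (π * ζ.im)
  · ring

theorem norm_inv_sub_mul_sin_smul_le_of_one_le_abs_im
    (hg : ∀ z, ‖g z‖ ≤ L * Real.exp (γ * |z.im|)) (hγ : γ ≤ π) (hζ : 1 ≤ π * |ζ.im|) :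
    ‖((ζ - x) * sin (π * ζ))⁻¹ • g ζ‖ ≤ 4 * L / |ζ.im| := by
  have hL : 0 ≤ L := by simpa using (norm_nonneg _).trans (hg 0)
  have him : 0 < |ζ.im| := pos_of_mul_pos_right (one_pos.trans_le hζ) Real.pi_pos.le
  have hexp : Real.exp (-(π - γ) * |ζ.im|) ≤ 1 :=
    Real.exp_le_one_iff.2 (mul_nonpos_of_nonpos_of_nonneg (by linarith) him.le)
  refine (norm_inv_sub_mul_sin_smul_le hg (a := 1 / 4) (by norm_num) him ?_ ?_).trans ?_
  · simpa using abs_im_le_norm (ζ - x)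
  · rw [mul_one_div]
    refine (exp_div_four_le_sinh hζ).trans ?_
    simpa [abs_mul, abs_of_pos Real.pi_pos] using sinh_abs_im_le_norm_sin (π * ζ)
  · calc L / (|ζ.im| * (1 / 4)) * Real.exp (-(π - γ) * |ζ.im|) ≤ L / (|ζ.im| * (1 / 4)) * 1 := by
          gcongr
      _ = 4 * L / |ζ.im| := by ring

theorem cos_pi_mul_intCast_add_half (n : ℤ) : Real.cos (π * (n + 1 / 2)) = 0 := by
  rw [mul_add, mul_one_div, Real.cos_add_pi_div_two, mul_comm, Real.sin_int_mul_pi, neg_zero]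

theorem norm_rectIntegral_inv_sub_mul_sin_smul_le
    (hg : ∀ z, ‖g z‖ ≤ L * Real.exp (γ * |z.im|)) (hγ : γ < π) {a b Y : ℝ}
    (ha : Real.cos (π * a) = 0) (hb : Real.cos (π * b) = 0) (hx : x ∈ Ioo a b) (hY : 1 ≤ π * Y) :
    ‖rectIntegral (fun ζ ↦ ((ζ - x) * sin (π * ζ))⁻¹ • g ζ) ⟨a, -Y⟩ ⟨b, Y⟩‖ ≤
      8 * L * (b - a) / Y + 4 * L / (π - γ) * (1 / (b - x) + 1 / (x - a)) := by
  have hY0 : 0 < Y := pos_of_mul_pos_right (one_pos.trans_le hY) Real.pi_pos.le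
  have hab : 0 < b - a := by linarith [hx.1, hx.2]
  have horizontal (y : ℝ) (hy : |y| = Y) :
      ‖∫ t : ℝ in a..b, ((t + y * I - x) * sin (π * (t + y * I)))⁻¹ • g (t + y * I)‖ ≤
        4 * L / Y * (b - a) := by
    rw [← abs_of_pos hab]
    refine intervalIntegral.norm_integral_le_of_norm_le_const fun t _ ↦ ?_
    simpa [hy] using norm_inv_sub_mul_sin_smul_le_of_one_le_abs_im (x := x) (ζ := t + y * I)
      hg hγ.le (by simpa [hy])
  have vertical (c : ℝ) (hc : Real.cos (π * c) = 0) (hcx : c ≠ x) :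
      ‖∫ y : ℝ in -Y..Y, ((c + y * I - x) * sin (π * (c + y * I)))⁻¹ • g (c + y * I)‖ ≤
        2 * L / |c - x| * (2 / (π - γ)) := by
    refine norm_intervalIntegral_le_of_norm_le_exp_neg_mul_abs (sub_pos.2 hγ) (by linarith)
      fun y ↦ ?_
    simpa using norm_inv_sub_mul_sin_smul_le_of_cos_re_eq_zero (x := x) (ζ := c + y * I) hg
      (by simpa using hc) (by simpa using hcx)
  calc ‖rectIntegral (fun ζ ↦ ((ζ - x) * sin (π * ζ))⁻¹ • g ζ) ⟨a, -Y⟩ ⟨b, Y⟩‖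
      ≤ 4 * L / Y * (b - a) + 4 * L / Y * (b - a) + 2 * L / |b - x| * (2 / (π - γ)) +
          2 * L / |a - x| * (2 / (π - γ)) := by
        refine norm_sub_le_of_le (norm_add_le_of_le (norm_sub_le_of_le
          (horizontal (-Y) (by simp [hY0.le])) (horizontal Y (by simp [hY0.le]))) ?_) ?_ <;>
        rw [norm_smul, norm_I, one_mul]
        exacts [vertical b hb hx.2.ne', vertical a ha hx.1.ne]
    _ = 8 * L * (b - a) / Y + 4 * L / (π - γ) * (1 / (b - x) + 1 / (x - a)) := by
        rw [abs_of_pos (sub_pos.2 hx.2), abs_sub_comm, abs_of_pos (sub_pos.2 hx.1)]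
        ring

theorem norm_sub_sum_sinc_smul_le [CompleteSpace E] (hg : Differentiable ℂ g)
    (hgL : ∀ z, ‖g z‖ ≤ L * Real.exp (γ * |z.im|)) (hγ : γ < π) {m M : ℤ}
    (hx : x ∈ Ioo (m - 1 / 2 : ℝ) (M + 1 / 2)) (hsin : Real.sin (π * x) ≠ 0) :
    ‖g x - ∑ n ∈ Finset.Icc m M, (Real.sinc (π * (x - n)) : ℂ) • g n‖ ≤
      2 * L * |Real.sin (π * x)| / (π * (π - γ)) *
        (1 / (M + 1 / 2 - x) + 1 / (x - (m - 1 / 2))) := by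
  let B := 4 * L / (π - γ) * (1 / (M + 1 / 2 - x) + 1 / (x - (m - 1 / 2)))
  have hbound : ∀ᶠ Y : ℝ in atTop,
      ‖g x - ∑ n ∈ Finset.Icc m M, (Real.sinc (π * (x - n)) : ℂ) • g n‖ ≤
        |Real.sin (π * x)| / (2 * π) * (8 * L * (M + 1 / 2 - (m - 1 / 2)) / Y + B) := by
    filter_upwards [eventually_ge_atTop (1 / π), eventually_gt_atTop 0] with Y hY hY0
    rw [sub_sum_sinc_smul_eq_rectIntegral hg hx hsin hY0, norm_smul]
    gcongr
    · rw [norm_div, norm_mul, norm_mul, norm_I, mul_one, ← ofReal_mul, ← ofReal_sin, norm_real,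
        norm_real, Real.norm_of_nonneg Real.pi_pos.le, Real.norm_eq_abs, norm_ofNat]
    · refine norm_rectIntegral_inv_sub_mul_sin_smul_le hgL hγ ?_
        (cos_pi_mul_intCast_add_half M) hx ((div_le_iff₀' Real.pi_pos).1 hY)
      rw [show (m - 1 / 2 : ℝ) = (m - 1 : ℤ) + 1 / 2 by push_cast; ring]
      exact cos_pi_mul_intCast_add_half (m - 1)
  have hlim : Tendsto (fun Y : ℝ ↦ |Real.sin (π * x)| / (2 * π) *
      (8 * L * (M + 1 / 2 - (m - 1 / 2)) / Y + B)) atTop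
      (𝓝 (|Real.sin (π * x)| / (2 * π) * (0 + B))) :=
    ((tendsto_const_nhds.div_atTop tendsto_id).add_const B).const_mul _
  refine (ge_of_tendsto hlim hbound).trans_eq ?_
  have : π - γ ≠ 0 := (sub_pos.2 hγ).ne'
  simp only [B]
  field_simp
  ring

end CardinalSeries

section TruncationError

variable {Λ : Type*} {f : ℂ → Λ → ℂ} {w t : ℝ} {N : ℕ} {l : Λ}

theorem truncSum_of_sin_eq_zero {Ω : Type*} (hw : w ≠ 0) (X : ℝ → Ω → ℂ) (ω : Ω)
    (ht : Real.sin (w * t) = 0) : truncSum w N X t ω = X t ω := by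
  obtain ⟨k, hk⟩ := Real.sin_eq_zero_iff.1 ht
  have htk : t = k * π / w := by rw [hk, mul_div_cancel_left₀ t hw]
  have hkmem : k ∈ sampleIndices w N t := by
    simp [mem_sampleIndices, mul_comm t w, ← hk, Real.pi_ne_zero]
  rw [truncSum, Finset.sum_eq_single_of_mem k hkmem fun n _ hn ↦ ?_]
  · simp [← htk, ← hk]
  · have hkn : (k - n : ℤ) * π ≠ 0 :=
      mul_ne_zero (Int.cast_ne_zero.2 (sub_ne_zero.2 hn.symm)) Real.pi_ne_zero
    rw [← hk, ← sub_mul, ← Int.cast_sub, Real.sinc_of_ne_zero hkn, Real.sin_int_mul_pi]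
    simp

theorem truncSum_eq_sum_sinc_smul (f : ℂ → Λ → ℂ) (w : ℝ) (N : ℕ) (t : ℝ) (l : Λ) :
    truncSum w N (fun s : ℝ ↦ f s) t l =
      ∑ n ∈ Finset.Icc ⌈t * w / π - N⌉ ⌊t * w / π + N⌋,
        (Real.sinc (π * (t * w / π - n)) : ℂ) • f (n * (π / w : ℝ)) l := by
  refine Finset.sum_congr rfl fun n _ ↦ ?_
  rw [smul_eq_mul, mul_comm, mul_sub, mul_div_cancel₀ _ Real.pi_ne_zero, mul_comm t, mul_comm π]
  push_cast
  rw [mul_div_assoc]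

theorem norm_sub_truncSum_le (hf : Differentiable ℂ (f · l)) {L γ : ℝ}
    (hfL : ∀ z, ‖f z l‖ ≤ L * Real.exp (γ * |z.im|)) (hw : 0 < w) (hγ : γ < w) (hN : 1 ≤ N)
    (ht : Real.sin (w * t) ≠ 0) :
    ‖f t l - truncSum w N (fun s : ℝ ↦ f s) t l‖ ≤
      8 * L * w * |Real.sin (w * t)| / (π ^ 2 * (w - γ) * N) := by
  have hL : 0 ≤ L := by simpa using (norm_nonneg _).trans (hfL 0)
  have hN' : (1 : ℝ) ≤ N := by exact_mod_cast hN
  have hδ : 0 < w - γ := sub_pos.2 hγ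
  set x : ℝ := t * w / π with hx
  have hπx : π * x = w * t := by rw [hx]; field_simp
  have hright : N / 2 ≤ ⌊x + N⌋ + 1 / 2 - x := by linarith [Int.lt_floor_add_one (x + N)]
  have hleft : N / 2 ≤ x - (⌈x - N⌉ - 1 / 2) := by linarith [Int.ceil_lt_add_one (x - N)]
  have hgL (z : ℂ) : ‖f (z * (π / w : ℝ)) l‖ ≤ L * Real.exp (γ * (π / w) * |z.im|) := by
    refine (hfL _).trans_eq ?_
    rw [im_mul_ofReal, abs_mul, abs_of_pos (div_pos Real.pi_pos hw)]
    ring_nf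
  calc ‖f t l - truncSum w N (fun s : ℝ ↦ f s) t l‖
      ≤ 2 * L * |Real.sin (π * x)| / (π * (π - γ * (π / w))) *
          (1 / (⌊x + N⌋ + 1 / 2 - x) + 1 / (x - (⌈x - N⌉ - 1 / 2))) := by
        have htx : t = x * (π / w) := by rw [hx]; field_simp
        rw [truncSum_eq_sum_sinc_smul, ← hx,
          show (t : ℂ) = x * (π / w : ℝ) from mod_cast congrArg ofReal htx]
        refine norm_sub_sum_sinc_smul_le (g := fun z ↦ f (z * (π / w : ℝ)) l)
          (hf.comp (by fun_prop)) hgL ?_ ⟨by linarith, by linarith⟩ (by rwa [hπx])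
        rwa [mul_div_left_comm, mul_lt_iff_lt_one_right Real.pi_pos, div_lt_one hw]
    _ ≤ 2 * L * |Real.sin (π * x)| / (π * (π - γ * (π / w))) * (1 / (N / 2) + 1 / (N / 2)) := by
        have : 0 ≤ π - γ * (π / w) := by
          rw [show π - γ * (π / w) = π / w * (w - γ) by field_simp]
          positivity
        gcongr
    _ = 8 * L * w * |Real.sin (w * t)| / (π ^ 2 * (w - γ) * N) := by
        rw [hπx, show π - γ * (π / w) = π / w * (w - γ) by field_simp]
        field_simp
        ring

theorem norm_kernel_ofReal_le_toReal_kernelSup (hL : kernelSup f ≠ ∞) (x : ℝ) :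
    ‖f x l‖ ≤ (kernelSup f).toReal := by
  rw [← toReal_enorm]
  exact ENNReal.toReal_mono hL (le_iSup₂ (f := fun (t : ℝ) (l : Λ) ↦ ‖f t l‖ₑ) x l)

theorem norm_kernel_le (hf : Differentiable ℂ (f · l)) (hγ : kernelType f ≠ ∞)
    (hL : kernelSup f ≠ ∞) (z : ℂ) :
    ‖f z l‖ ≤ (kernelSup f).toReal * Real.exp ((kernelType f).toReal * |z.im|) := by
  have hτ {τ : ℝ} (hτ : (kernelType f).toReal < τ) :
      ‖f z l‖ ≤ (kernelSup f).toReal * Real.exp (τ * |z.im|) := by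
    have hlt : limsup (fun n : ℕ ↦ ‖iteratedDeriv n (f · l) 0‖ₑ ^ (1 / n : ℝ)) atTop <
        ENNReal.ofReal τ :=
      (le_iSup (fun l ↦ limsup (fun n : ℕ ↦ ‖iteratedDeriv n (f · l) 0‖ₑ ^ (1 / n : ℝ)) atTop)
        l).trans_lt ((ENNReal.lt_ofReal_iff_toReal_lt hγ).2 hτ)
    exact norm_le_mul_exp_abs_im hf (isBigO_exp_of_iteratedDeriv_isBigO_pow hf
      (ENNReal.toReal_nonneg.trans_lt hτ) (isBigO_pow_of_limsup_enorm_rpow_lt hlt))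
      (norm_kernel_ofReal_le_toReal_kernelSup hL) z
  have hcont : Continuous fun τ : ℝ ↦ (kernelSup f).toReal * Real.exp (τ * |z.im|) := by fun_prop
  exact ge_of_tendsto ((hcont.tendsto _).mono_left (nhdsWithin_le_nhds (s := Ioi _)))
    (eventually_mem_nhdsWithin.mono fun _ ↦ hτ)

theorem one_sub_exp_neg_pi_pos : 0 < 1 - Real.exp (-π) :=
  sub_pos.2 (Real.exp_lt_one_iff.2 (neg_lt_zero.2 Real.pi_pos))

theorem toReal_kernelType_lt (hw : kernelType f < ENNReal.ofReal w) : (kernelType f).toReal < w :=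
  (ENNReal.lt_ofReal_iff_toReal_lt hw.ne_top).1 hw

theorem truncConst_factor_pos (hw : kernelType f < ENNReal.ofReal w)
    (ht : Real.sin (w * t) ≠ 0) :
    0 < w * |Real.sin (w * t)| / (π * (w - (kernelType f).toReal) * (1 - Real.exp (-π))) := by
  have : 0 < w := ENNReal.ofReal_pos.1 (pos_of_gt hw)
  have := sub_pos.2 (toReal_kernelType_lt hw)
  have := one_sub_exp_neg_pi_pos
  positivity

theorem truncConst_ne_zero (hw : kernelType f < ENNReal.ofReal w) (ht : Real.sin (w * t) ≠ 0)
    (hf : kernelSup f ≠ 0) : truncConst w f t ≠ 0 :=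
  mul_ne_zero (mul_ne_zero four_ne_zero hf)
    (ENNReal.ofReal_pos.2 (truncConst_factor_pos hw ht)).ne'

theorem truncConst_eq_top (hw : kernelType f < ENNReal.ofReal w) (ht : Real.sin (w * t) ≠ 0)
    (hf : kernelSup f = ∞) : truncConst w f t = ∞ := by
  rw [truncConst, hf, ENNReal.mul_top four_ne_zero,
    ENNReal.top_mul (ENNReal.ofReal_pos.2 (truncConst_factor_pos hw ht)).ne']

theorem enorm_sub_truncSum_le (hf : Differentiable ℂ (f · l))
    (hw : kernelType f < ENNReal.ofReal w) (hN : 1 ≤ N) :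
    ‖f t l - truncSum w N (fun s : ℝ ↦ f s) t l‖ₑ ≤
      ENNReal.ofReal (2 / π) * (truncConst w f t / N) := by
  have hw0 : 0 < w := ENNReal.ofReal_pos.1 (pos_of_gt hw)
  have hγ := toReal_kernelType_lt hw
  by_cases ht : Real.sin (w * t) = 0
  · simp [truncSum_of_sin_eq_zero hw0.ne' _ _ ht]
  by_cases hL : kernelSup f = ∞
  · rw [truncConst_eq_top hw ht hL, ENNReal.top_div_of_ne_top (ENNReal.natCast_ne_top N),
      ENNReal.mul_top (ENNReal.ofReal_pos.2 (by positivity)).ne']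
    exact le_top
  have hN0 : (0 : ℝ) < N := by exact_mod_cast hN
  have hδ := sub_pos.2 hγ
  have hexp := one_sub_exp_neg_pi_pos
  calc ‖f t l - truncSum w N (fun s : ℝ ↦ f s) t l‖ₑ
      ≤ ENNReal.ofReal (8 * (kernelSup f).toReal * w * |Real.sin (w * t)| /
          (π ^ 2 * (w - (kernelType f).toReal) * N)) := by
        rw [← ofReal_norm]
        exact ENNReal.ofReal_le_ofReal
          (norm_sub_truncSum_le hf (norm_kernel_le hf hw.ne_top hL) hw0 hγ hN ht)
    _ = ENNReal.ofReal (2 / π * (4 * (kernelSup f).toReal * (w * |Real.sin (w * t)| /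
          (π * (w - (kernelType f).toReal) * 1)) / N)) := by
        congr 1
        field_simp
        ring
    _ ≤ ENNReal.ofReal (2 / π * (4 * (kernelSup f).toReal * (w * |Real.sin (w * t)| /
          (π * (w - (kernelType f).toReal) * (1 - Real.exp (-π)))) / N)) := by
        gcongr
        exact sub_le_self _ (Real.exp_pos _).le
    _ = ENNReal.ofReal (2 / π) * (truncConst w f t / N) := by
        rw [ENNReal.ofReal_mul (by positivity), ENNReal.ofReal_div_of_pos hN0,
          ENNReal.ofReal_mul (by positivity), ENNReal.ofReal_mul (by positivity),
          ENNReal.ofReal_toReal hL, ENNReal.ofReal_natCast, ENNReal.ofReal_ofNat, truncConst]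

end TruncationError

section CramerClass

theorem complexMeasure_integral_const_mul {α : Type*} [MeasurableSpace α]
    (F : ComplexMeasure α) (c : ℂ) (g : α → ℂ) :
    F.integral (fun x ↦ c * g x) (ContinuousLinearMap.mul ℝ ℂ) =
      c * F.integral g (ContinuousLinearMap.mul ℝ ℂ) :=
  setToFun_smul _ (fun c s x ↦ by simp [VectorMeasure.transpose, mul_left_comm]) c g

/-- The process `X` belongs to the Cramér class of the kernel `φ` and the spectral measure `F`: its
values are square integrable and `E X(t) X(s)* = ∫∫ φ(t, l) φ(s, m)* F(dl, dm)`, where the double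
integral exists as a Lebesgue integral. The index set `T` is arbitrary, so that the family of all
finite linear combinations of the values of `X` is again such a process. -/
structure HasCramerRepresentation {T Ω Λ : Type*} [MeasurableSpace Ω] [MeasurableSpace Λ]
    (P : Measure Ω) (X : T → Ω → ℂ) (φ : T → Λ → ℂ) (F : ComplexMeasure (Λ × Λ)) : Prop where
  memLp : ∀ t, MemLp (X t) 2 P
  integrable : ∀ t s, Integrable (fun p : Λ × Λ ↦ φ t p.1 * conj (φ s p.2)) F.variation
  covariance : ∀ t s, ∫ ω, X t ω * conj (X s ω) ∂P =
    F.integral (fun p : Λ × Λ ↦ φ t p.1 * conj (φ s p.2)) (ContinuousLinearMap.mul ℝ ℂ)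

variable {T Ω Λ : Type*} [MeasurableSpace Ω] [MeasurableSpace Λ] {P : Measure Ω}
  {X : T → Ω → ℂ} {φ : T → Λ → ℂ} {F : ComplexMeasure (Λ × Λ)}

namespace HasCramerRepresentation

theorem comp {S : Type*} (h : HasCramerRepresentation P X φ F) (u : S → T) :
    HasCramerRepresentation P (fun s ↦ X (u s)) (fun s ↦ φ (u s)) F :=
  ⟨fun s ↦ h.memLp (u s), fun s s' ↦ h.integrable (u s) (u s'),
    fun s s' ↦ h.covariance (u s) (u s')⟩

theorem memLp_linearCombination (h : HasCramerRepresentation P X φ F) (c : T →₀ ℂ) :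
    MemLp (Finsupp.linearCombination ℂ X c) 2 P := by
  induction c using Finsupp.induction_linear with
  | zero => simp
  | add c c' hc hc' => simpa using hc.add hc'
  | single t a => simpa using (h.memLp t).const_smul a

theorem integrable_linearCombination (h : HasCramerRepresentation P X φ F) (c d : T →₀ ℂ) :
    Integrable (fun p : Λ × Λ ↦ Finsupp.linearCombination ℂ φ c p.1 *
      conj (Finsupp.linearCombination ℂ φ d p.2)) F.variation := by
  induction c using Finsupp.induction_linear with
  | zero => simp
  | add c c' hc hc' => simpa [add_mul] using hc.fun_add hc'
  | single t a =>
    induction d using Finsupp.induction_linear with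
    | zero => simp
    | add d d' hd hd' => simpa [mul_add] using hd.fun_add hd'
    | single s b => simpa [mul_mul_mul_comm] using (h.integrable t s).const_mul (a * conj b)

theorem linearCombination (h : HasCramerRepresentation P X φ F) :
    HasCramerRepresentation P (Finsupp.linearCombination ℂ X) (Finsupp.linearCombination ℂ φ)
      F := by
  have integrable (c d : T →₀ ℂ) : Integrable (fun ω ↦ Finsupp.linearCombination ℂ X c ω *
      conj (Finsupp.linearCombination ℂ X d ω)) P :=
    (h.memLp_linearCombination c).integrable_mul (h.memLp_linearCombination d).star
  refine ⟨h.memLp_linearCombination, h.integrable_linearCombination, fun c d ↦ ?_⟩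
  induction c using Finsupp.induction_linear with
  | zero => simp
  | add c c' hc hc' =>
    simp only [map_add, Pi.add_apply, add_mul]
    rw [integral_add (integrable c d) (integrable c' d), hc, hc', VectorMeasure.integral_fun_add
      (h.integrable_linearCombination c d) (h.integrable_linearCombination c' d)]
  | single t a =>
    induction d using Finsupp.induction_linear with
    | zero => simp
    | add d d' hd hd' =>
      simp only [map_add, Pi.add_apply, mul_add]
      rw [integral_add (integrable _ d) (integrable _ d'), hd, hd', VectorMeasure.integral_fun_add
        (h.integrable_linearCombination _ d) (h.integrable_linearCombination _ d')]
    | single s b =>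
      simp only [Finsupp.linearCombination_single, Pi.smul_apply, smul_eq_mul, map_mul,
        mul_mul_mul_comm a _ (conj b)]
      rw [integral_const_mul, complexMeasure_integral_const_mul, h.covariance]

theorem lintegral_enorm_sq_eq (h : HasCramerRepresentation P X φ F) (t : T) :
    ∫⁻ ω, ‖X t ω‖ₑ ^ 2 ∂P = ‖F.integral (fun p : Λ × Λ ↦ φ t p.1 * conj (φ t p.2))
      (ContinuousLinearMap.mul ℝ ℂ)‖ₑ := by
  have hnonneg : 0 ≤ ∫ ω, ‖X t ω‖ ^ 2 ∂P := integral_nonneg fun ω ↦ sq_nonneg _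
  calc ∫⁻ ω, ‖X t ω‖ₑ ^ 2 ∂P = ∫⁻ ω, ENNReal.ofReal (‖X t ω‖ ^ 2) ∂P := by
        simp only [ENNReal.ofReal_pow (norm_nonneg _), ofReal_norm]
    _ = ENNReal.ofReal (∫ ω, ‖X t ω‖ ^ 2 ∂P) :=
        (ofReal_integral_eq_lintegral_ofReal ((h.memLp t).integrable_norm_pow two_ne_zero)
          (.of_forall fun ω ↦ sq_nonneg _)).symm
    _ = ‖∫ ω, X t ω * conj (X t ω) ∂P‖ₑ := by
        simp only [mul_conj', ← ofReal_pow, integral_complex_ofReal]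
        rw [← ofReal_norm, norm_real, Real.norm_of_nonneg hnonneg]
    _ = _ := by rw [h.covariance]

theorem lintegral_enorm_sq_lt_top (h : HasCramerRepresentation P X φ F) (t : T) :
    ∫⁻ ω, ‖X t ω‖ₑ ^ 2 ∂P < ∞ :=
  (h.lintegral_enorm_sq_eq t).trans_lt enorm_lt_top

theorem lintegral_enorm_sq_le (h : HasCramerRepresentation P X φ F) {t : T} {C : ℝ≥0∞}
    (hC : ∀ l, ‖φ t l‖ₑ ≤ C) : ∫⁻ ω, ‖X t ω‖ₑ ^ 2 ∂P ≤ C ^ 2 * F.variation univ := by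
  have hmul : ‖ContinuousLinearMap.mul ℝ ℂ‖ₑ ≤ 1 := by simp [← ofReal_norm]
  calc ∫⁻ ω, ‖X t ω‖ₑ ^ 2 ∂P
      ≤ C ^ 2 * ‖ContinuousLinearMap.mul ℝ ℂ‖ₑ * F.variation univ := by
        rw [h.lintegral_enorm_sq_eq]
        refine VectorMeasure.enorm_integral_le_of_enorm_le_const (.of_forall fun p ↦ ?_)
        rw [enorm_mul, sq, RCLike.enorm_conj]
        gcongr <;> exact hC _
    _ ≤ C ^ 2 * F.variation univ := by
        gcongr
        exact mul_le_of_le_one_right' hmul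

end HasCramerRepresentation

theorem IsPiranashvili.hasCramerRepresentation {ξ : ℝ → Ω → ℂ} {f : ℂ → Λ → ℂ}
    (hξ : IsPiranashvili P ξ f F) : HasCramerRepresentation P ξ (fun t : ℝ ↦ f t) F :=
  ⟨hξ.memLp, hξ.integrable, hξ.covariance⟩

theorem sub_truncSum_eq_linearCombination {Ω : Type*} (w : ℝ) (N : ℕ) (X : ℝ → Ω → ℂ) (t : ℝ) :
    (fun ω ↦ X t ω - truncSum w N X t ω) = Finsupp.linearCombination ℂ X (.single t 1 -
      ∑ n ∈ sampleIndices w N t, .single (n * π / w) (Real.sinc (w * t - n * π) : ℂ)) := by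
  ext ω
  simp [truncSum, mul_comm]

theorem HasCramerRepresentation.sub_truncSum {ξ : ℝ → Ω → ℂ} {κ : ℝ → Λ → ℂ}
    (h : HasCramerRepresentation P ξ κ F) (w : ℝ) (N : ℕ) :
    HasCramerRepresentation P (fun t ω ↦ ξ t ω - truncSum w N ξ t ω)
      (fun t l ↦ κ t l - truncSum w N κ t l) F := by
  convert h.linearCombination.comp fun t ↦ .single t 1 -
    ∑ n ∈ sampleIndices w N t, .single (n * π / w) (Real.sinc (w * t - n * π) : ℂ) using 2 <;>
  exact sub_truncSum_eq_linearCombination ..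

end CramerClass

theorem ennreal_lt_of_le_mul_of_lt_one {a c x : ℝ≥0∞} (h : x ≤ c * a) (hc : c < 1) (ha : a ≠ 0)
    (hx : x ≠ ∞) : x < a := by
  obtain rfl | ha' := eq_or_ne a ∞
  · exact hx.lt_top
  · exact h.trans_lt (by simpa using (ENNReal.mul_lt_mul_iff_left ha ha').2 hc)

theorem theorem2_general {Ω Λ : Type*} [MeasurableSpace Ω] [MeasurableSpace Λ]
    {P : Measure Ω} {ξ : ℝ → Ω → ℂ} {f : ℂ → Λ → ℂ} {F : ComplexMeasure (Λ × Λ)}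
    (hξ : HasCramerRepresentation P ξ (fun t : ℝ ↦ f t) F)
    (hf : ∀ l, Differentiable ℂ (fun z ↦ f z l)) {w : ℝ} (hw : kernelType f < ENNReal.ofReal w)
    {N : ℕ} (hN : 1 ≤ N) (t : ℝ) :
    (∫⁻ ω, ‖ξ t ω - truncSum w N ξ t ω‖ₑ ^ 2 ∂P ≤
      truncConst w f t ^ 2 / (N : ℝ≥0∞) ^ 2 * F.variation univ) ∧
    (Real.sin (w * t) ≠ 0 → kernelSup f ≠ 0 → F.variation univ ≠ 0 →
      ∫⁻ ω, ‖ξ t ω - truncSum w N ξ t ω‖ₑ ^ 2 ∂P <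
        truncConst w f t ^ 2 / (N : ℝ≥0∞) ^ 2 * F.variation univ) := by
  have hle : ∫⁻ ω, ‖ξ t ω - truncSum w N ξ t ω‖ₑ ^ 2 ∂P ≤ ENNReal.ofReal (2 / π) ^ 2 *
      (truncConst w f t ^ 2 / (N : ℝ≥0∞) ^ 2 * F.variation univ) := by
    refine ((hξ.sub_truncSum w N).lintegral_enorm_sq_le fun l ↦
      enorm_sub_truncSum_le (hf l) hw hN).trans_eq ?_
    simp only [div_eq_mul_inv, mul_pow, ENNReal.inv_pow, mul_assoc]
  have hc : ENNReal.ofReal (2 / π) ^ 2 < 1 := by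
    refine pow_lt_one₀ zero_le ?_ two_ne_zero
    rw [ENNReal.ofReal_lt_one, div_lt_one Real.pi_pos]
    exact Real.pi_gt_three.trans' (by norm_num)
  refine ⟨hle.trans (mul_le_of_le_one_left' hc.le), fun ht hsup hF ↦
    ennreal_lt_of_le_mul_of_lt_one hle hc (mul_ne_zero (ENNReal.div_ne_zero.2 ?_) hF)
      ((hξ.sub_truncSum w N).lintegral_enorm_sq_lt_top t).ne⟩
  exact ⟨pow_ne_zero 2 (truncConst_ne_zero hw ht hsup), by finiteness⟩

theorem theorem2 {Ω Λ : Type*} [MeasurableSpace Ω] [MeasurableSpace Λ]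
    (P : Measure Ω) [IsProbabilityMeasure P]
    (ξ : ℝ → Ω → ℂ) (f : ℂ → Λ → ℂ) (F : ComplexMeasure (Λ × Λ))
    (hξ : IsPiranashvili P ξ f F)
    (w : ℝ) (hw : kernelType f < ENNReal.ofReal w) :
    ∃ N₀ : ℕ, ∀ N : ℕ, N₀ ≤ N → ∀ t : ℝ,
      (∫⁻ ω, ‖ξ t ω - truncSum w N ξ t ω‖ₑ ^ 2 ∂P ≤
        truncConst w f t ^ 2 / (N : ℝ≥0∞) ^ 2 * F.variation Set.univ) ∧
      (Real.sin (w * t) ≠ 0 → kernelSup f ≠ 0 → F.variation Set.univ ≠ 0 →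
        ∫⁻ ω, ‖ξ t ω - truncSum w N ξ t ω‖ₑ ^ 2 ∂P <
          truncConst w f t ^ 2 / (N : ℝ≥0∞) ^ 2 * F.variation Set.univ) := by
  exact ⟨1, fun N hN t ↦
    theorem2_general hξ.hasCramerRepresentation (fun l ↦ (hξ.kernel l).1) hw hN t⟩
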